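/- Let $G=(V,E,b)$ be a connected power network: a finite connected simple graph $(V,E)$ with an arbitrary orientation of its edges (lines) and susceptances $b_\ell>0$, $\ell\in E$. Let $C\in\{-1,0,1\}^{V\times E}$ be the incidence matrix ($+1$ at the source and $-1$ at the target of a line), $B=\mathrm{diag}(b_\ell)$, $L=CBC^T$ and $L^\dagger$ its Moore–Penrose pseudo-inverse. For a balanced injection vector $p\in\mathrm{im}(L)$ the line flows are $f=BC^TL^\dagger p$. The PTDF matrix $D$ has as entry $D_{\ell\hat\ell}$, with $\hat\ell=(s,t)$, the change of the flow on $\ell$ when one unit of power is injected at $s$ and withdrawn at $t$. A subscript such as $B_S$, $C_S$, $D_{S,T}$ denotes the submatrix on the lines in $S$ (rows $S$ and columns $T$ for $D$; columns $S$ for $C$). The blocks of $G$ are the classes $E_j$ of the equivalence relation on $E$ under which two lines are equivalent if they are equal or lie on a common simple cycle. Let $\mathcal E\subseteq E$ be a non-cut set, i.e. $(V,E\setminus\mathcal E)$ is connected, and write $-\mathcal E:=E\setminus\mathcal E$, $\mathcal E_j:=\mathcal E\cap E_j$, $\mathcal E_{-j}:=E_j\setminus\mathcal E$. Write $B_j,C_j$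 and $B_{-j},C_{-j}$ for the submatrices on $\mathcal E_j$ and $\mathcal E_{-j}$, $D_j:=D_{\mathcal E_j,\mathcal E_j}$, $D_{-j}:=D_{\mathcal E_{-j},\mathcal E_j}$ and $K_j:=D_{-j}(I-\mathrm{diag}(D_j))^{-1}$. Then the following hold. 1. $I-D_{\mathcal E,\mathcal E}$ is invertible, and the GLODF matrix $K^{\mathcal E}:=D_{-\mathcal E,\mathcal E}(I-D_{\mathcal E,\mathcal E})^{-1}$ satisfies $\tilde f_{-\mathcal E}-f_{-\mathcal E}=K^{\mathcal E}f_{\mathcal E}$ for every balanced $p$, where $\tilde f_{-\mathcal E}=B_{-\mathcal E}C_{-\mathcal E}^T(C_{-\mathcal E}B_{-\mathcal E}C_{-\mathcal E}^T)^\dagger p$ are the flows with the same injections in the network from which $\mathcal E$ has been removed. 2. With the lines of $-\mathcal E$ and of $\mathcal E$ grouped by blocks, $K^{\mathcal E}$ is block-diagonal with (rectangular) diagonal pieces, one for each block $E_j$, $$K^{\mathcal E}_j=B_{-j}C_{-j}^TL^\dagger C_j\,(I-B_jC_j^TL^\dagger C_j)^{-1}.$$ 3. For every $j$, the matrices $I-D_j$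 and $I-\mathrm{diag}(D_j)$ are invertible, and $$K^{\mathcal E}_j=D_{-j}(I-D_j)^{-1}=K_j\,(I-\mathrm{diag}(D_j))\,(I-D_j)^{-1}.$$ Moreover, the entries of $K_j$ are the single-line outage factors (LODFs): for $\ell\in\mathcal E_{-j}$, $\hat\ell\in\mathcal E_j$ and every balanced $p$, removing only the line $\hat\ell$ changes the flow on $\ell$ by $(K_j)_{\ell\hat\ell}\,f_{\hat\ell}$. 4. If $\ell\in-\mathcal E$ and $\hat\ell\in\mathcal E$ lie in different blocks of $G$, then $K^{\mathcal E}_{\ell\hat\ell}=0$. -/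

import Mathlib

open scoped Classical Matrix

/-! ### The Moore–Penrose pseudo-inverse of a real symmetric matrix -/

/-- `X` is the Moore–Penrose pseudo-inverse of the real matrix `A`: the four Penrose equations. -/
structure IsPseudoInverse {n : Type*} [Fintype n] (A X : Matrix n n ℝ) : Prop where
  mul_mul_left : A * X * A = A
  mul_mul_right : X * A * X = X
  symm_left : (A * X)ᵀ = A * X
  symm_right : (X * A)ᵀ = X * A

/-- The Moore–Penrose pseudo-inverse `A† = ∑_{λᵢ ≠ 0} λᵢ⁻¹ vᵢ vᵢᵀ` of a real symmetric matrix,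
obtained by inverting the nonzero eigenvalues (here `0⁻¹ = 0`). -/
noncomputable def symPinv {n : Type*} [Fintype n] (A : Matrix n n ℝ) (hA : A.IsHermitian) :
    Matrix n n ℝ :=
  hA.cfc (fun x => x⁻¹)

theorem symPinv_isPseudoInverse {n : Type*} [Fintype n] (A : Matrix n n ℝ) (hA : A.IsHermitian) :
    IsPseudoInverse A (symPinv A hA) := by
  have key : ∀ f g : ℝ → ℝ, hA.cfc f * hA.cfc g = hA.cfc (fun x => f x * g x) := by
    intro f g
    unfold Matrix.IsHermitian.cfc
    rw [← map_mul, Matrix.diagonal_mul_diagonal]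
    congr 2
  have hid : A = hA.cfc (fun x => x) := hA.spectral_theorem
  have hsym : ∀ f : ℝ → ℝ, (hA.cfc f)ᵀ = hA.cfc f := by
    intro f
    rw [← Matrix.conjTranspose_eq_transpose_of_trivial, ← Matrix.star_eq_conjTranspose]
    unfold Matrix.IsHermitian.cfc
    rw [← map_star, Matrix.star_eq_conjTranspose, Matrix.diagonal_conjTranspose]
    congr 2
  have h1 : A * symPinv A hA = hA.cfc (fun x => x * x⁻¹) :=
    (congrArg (· * symPinv A hA) hid).trans (key _ _)
  have h2 : symPinv A hA * A = hA.cfc (fun x => x⁻¹ * x) :=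
    (congrArg (symPinv A hA * ·) hid).trans (key _ _)
  refine ⟨?_, ?_, by rw [h1, hsym], by rw [h2, hsym]⟩
  · rw [h1]
    refine (congrArg (hA.cfc (fun x => x * x⁻¹) * ·) hid).trans ((key _ _).trans ?_)
    refine Eq.trans ?_ hid.symm
    congr 1
    ext x
    by_cases hx : x = 0 <;> simp [hx]
  · rw [h2]
    unfold symPinv
    rw [key]
    congr 1
    ext x
    by_cases hx : x = 0 <;> simp [hx]

theorem IsPseudoInverse.unique {n : Type*} [Fintype n] {A X Y : Matrix n n ℝ}
    (hX : IsPseudoInverse A X) (hY : IsPseudoInverse A Y) : X = Y := by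
  have h1 : A * X = A * Y := by
    calc A * X = (A * X)ᵀ := hX.symm_left.symm
      _ = ((A * Y) * (A * X))ᵀ := by
        rw [← Matrix.mul_assoc, hY.mul_mul_left]
      _ = (A * X) * (A * Y) := by rw [Matrix.transpose_mul, hX.symm_left, hY.symm_left]
      _ = A * Y := by rw [← Matrix.mul_assoc, hX.mul_mul_left]
  have h2 : X * A = Y * A := by
    calc X * A = (X * A)ᵀ := hX.symm_right.symm
      _ = ((X * A) * (Y * A))ᵀ := by
        rw [Matrix.mul_assoc, ← Matrix.mul_assoc A Y A, hY.mul_mul_left]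
      _ = (Y * A) * (X * A) := by rw [Matrix.transpose_mul, hX.symm_right, hY.symm_right]
      _ = Y * A := by rw [Matrix.mul_assoc, ← Matrix.mul_assoc A X A, hX.mul_mul_left]
  calc X = X * A * X := hX.mul_mul_right.symm
    _ = Y * A * X := by rw [h2]
    _ = Y * (A * X) := Matrix.mul_assoc _ _ _
    _ = Y * (A * Y) := by rw [h1]
    _ = Y * A * Y := (Matrix.mul_assoc _ _ _).symm
    _ = Y := hY.mul_mul_right

/-! ### The block decomposition of the edge set of a graph -/

namespace SimpleGraph

variable {V : Type*} {G : SimpleGraph V}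

theorem Walk.IsCycle.exists_isPath_of_ne {w x y : V} {c : G.Walk w w} (hc : c.IsCycle)
    (hx : x ∈ c.support) (hy : y ∈ c.support) (hxy : x ≠ y) {e : Sym2 V} (he : e ∈ c.edges) :
    ∃ q : G.Walk x y, q.IsPath ∧ e ∈ q.edges ∧ ∀ v ∈ q.support, v ∈ c.support := by
  have hd : (c.rotate x hx).IsCycle := hc.rotate hx
  have hsup : ∀ v, v ∈ (c.rotate x hx).support ↔ v ∈ c.support := fun v =>
    c.mem_support_rotate_iff x hx
  have hed : e ∈ (c.rotate x hx).edges := (c.rotate_edges x hx).perm.mem_iff.2 he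
  generalize c.rotate x hx = d at hd hsup hed
  have hy' : y ∈ d.support := (hsup y).2 hy
  have hspec := d.take_spec hy'
  have hcyc : ((d.takeUntil y hy').append (d.dropUntil y hy')).IsCycle := by rwa [hspec]
  rw [← hspec, Walk.edges_append, List.mem_append] at hed
  rcases hed with h | h
  · exact ⟨d.takeUntil y hy', hcyc.isPath_of_append_left (Walk.not_nil_of_ne hxy.symm), h,
      fun v hv => (hsup v).1 (d.support_takeUntil_subset_support hy' hv)⟩
  · refine ⟨(d.dropUntil y hy').reverse,
      (hcyc.isPath_of_append_right (Walk.not_nil_of_ne hxy)).reverse, by simpa using h, ?_⟩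
    intro v hv
    rw [Walk.support_reverse, List.mem_reverse] at hv
    exact (hsup v).1 (d.support_dropUntil_subset_support hy' hv)

theorem Walk.IsPath.exists_ear (S : Set V) {e : Sym2 V} (n : ℕ) :
    ∀ {x y : V} (p : G.Walk x y), p.length = n → p.IsPath → e ∈ p.edges → x ∈ S → y ∈ S →
      ∃ (x' y' : V) (q : G.Walk x' y'), q.IsPath ∧ e ∈ q.edges ∧ x' ∈ S ∧ y' ∈ S ∧
        ∀ v ∈ q.support, v ∈ S → v = x' ∨ v = y' := by
  induction n using Nat.strong_induction_on with
  | _ n ih =>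
    intro x y p hn hp he hx hy
    by_cases h : ∀ v ∈ p.support, v ∈ S → v = x ∨ v = y
    · exact ⟨x, y, p, hp, he, hx, hy, h⟩
    · push Not at h
      obtain ⟨v, hv, hvS, hvx, hvy⟩ := h
      have he' := he
      rw [← p.take_spec hv, Walk.edges_append, List.mem_append] at he'
      rcases he' with h | h
      · exact ih _ (hn ▸ p.length_takeUntil_lt_length hv hvy) _ rfl (hp.takeUntil hv) h hx hvS
      · exact ih _ (hn ▸ p.length_dropUntil_lt_length hv hvx) _ rfl (hp.dropUntil hv) h hvS hy

/-- Two edges lie in the same block if they coincide or lie on a common cycle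
(a closed walk whose only repeated vertices are the first and the last one). -/
def SameBlock (G : SimpleGraph V) (e f : G.edgeSet) : Prop :=
  e = f ∨ ∃ (v : V) (c : G.Walk v v), c.IsCycle ∧ (e : Sym2 V) ∈ c.edges ∧ (f : Sym2 V) ∈ c.edges

theorem SameBlock.trans {e f g : G.edgeSet} (h₁ : G.SameBlock e f) (h₂ : G.SameBlock f g) :
    G.SameBlock e g := by
  rcases h₁ with rfl | ⟨u, c, hc, hec, hfc⟩
  · exact h₂
  rcases h₂ with rfl | ⟨w, d, hd, hfd, hgd⟩
  · exact Or.inr ⟨u, c, hc, hec, hfc⟩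
  by_cases heg : e = g
  · exact Or.inl heg
  obtain ⟨f, hf⟩ := f
  induction f with
  | _ a b =>
    have hab : a ≠ b := G.ne_of_adj (G.mem_edgeSet.1 hf)
    obtain ⟨p, hp, hep, -⟩ := hc.exists_isPath_of_ne
      (c.fst_mem_support_of_mem_edges hfc) (c.snd_mem_support_of_mem_edges hfc) hab hec
    obtain ⟨x, y, q, hq, heq, hx, hy, hqS⟩ := Walk.IsPath.exists_ear {v | v ∈ d.support} _ p rfl hp
      hep (d.fst_mem_support_of_mem_edges hfd) (d.snd_mem_support_of_mem_edges hfd)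
    have hxy : x ≠ y := by
      rintro rfl
      rw [(Walk.isPath_iff_nil.1 hq).eq_nil] at heq
      simp at heq
    obtain ⟨r, hr, hgr, hrS⟩ := hd.exists_isPath_of_ne hy hx hxy.symm hgd
    refine Or.inr ⟨x, q.append r, hq.isCycle_append hr ?_ ?_, ?_, ?_⟩
    · rw [List.disjoint_left]
      intro v hvq hvr
      have hvq' := List.mem_of_mem_tail hvq
      have hvr' := List.mem_of_mem_tail hvr
      rcases hqS v hvq' (hrS v hvr') with rfl | rfl
      · have := hq.support_nodup
        rw [← Walk.cons_tail_support] at this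
        exact (List.nodup_cons.1 this).1 hvq
      · have := hr.support_nodup
        rw [← Walk.cons_tail_support] at this
        exact (List.nodup_cons.1 this).1 hvr
    · by_contra hlen
      push Not at hlen
      have h1 : q.length ≤ 1 := hlen.1
      have h2 : r.length ≤ 1 := hlen.2
      apply heg
      apply Subtype.ext
      have key : ∀ {s t : V} (z : G.Walk s t) (k : Sym2 V), z.length ≤ 1 → k ∈ z.edges →
          k = s(s, t) := by
        intro s t z k hz hk
        cases z with
        | nil => simp at hk
        | cons h z' =>
          cases z' with
          | nil => simpa using hk
          | cons h' z'' => simp at hz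
      rw [key q _ h1 heq, key r _ h2 hgr, Sym2.eq_swap]
    · rw [Walk.edges_append, List.mem_append]
      exact Or.inl heq
    · rw [Walk.edges_append, List.mem_append]
      exact Or.inr hgr

/-- The equivalence relation on edges whose classes are the (edge sets of the) blocks of `G`. -/
def blockSetoid (G : SimpleGraph V) : Setoid G.edgeSet where
  r := G.SameBlock
  iseqv :=
    ⟨fun _ => Or.inl rfl,
     fun h => h.elim (fun h => Or.inl h.symm)
      (fun ⟨v, c, hc, he, hf⟩ => Or.inr ⟨v, c, hc, hf, he⟩),
     fun h₁ h₂ => h₁.trans h₂⟩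

end SimpleGraph

/-! ### Power networks and the DC power flow model -/

/-- A connected power network: a connected simple graph, an (arbitrary) orientation of its lines
given by a source and a target of every line, and positive line susceptances. -/
structure PowerNetwork (V : Type*) where
  graph : SimpleGraph V
  connected : graph.Connected
  src : graph.edgeSet → V
  tgt : graph.edgeSet → V
  src_tgt : ∀ l : graph.edgeSet, s(src l, tgt l) = (l : Sym2 V)
  susceptance : graph.edgeSet → ℝ
  susceptance_pos : ∀ l, 0 < susceptance l

namespace PowerNetwork

variable {V : Type*} [Fintype V]

/-- The lines (edges) of the network. -/
abbrev Line (N : PowerNetwork V) : Type _ := N.graph.edgeSet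

/-- The diagonal matrix `B` of susceptances. -/
noncomputable def B (N : PowerNetwork V) : Matrix N.Line N.Line ℝ :=
  Matrix.diagonal N.susceptance

/-- The vertex-edge incidence matrix `C`. -/
noncomputable def C (N : PowerNetwork V) : Matrix V N.Line ℝ :=
  Matrix.of fun i l => if i = N.src l then 1 else if i = N.tgt l then -1 else 0

/-- The diagonal submatrix `B_S` of `B` on a set `S` of lines. -/
noncomputable def BSub (N : PowerNetwork V) (S : Set N.Line) : Matrix S S ℝ :=
  N.B.submatrix Subtype.val Subtype.val

/-- The submatrix `C_S` of `C` formed by the columns of a set `S` of lines. -/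
noncomputable def CSub (N : PowerNetwork V) (S : Set N.Line) : Matrix V S ℝ :=
  N.C.submatrix id Subtype.val

/-- The weighted Laplacian `L = C B Cᵀ`. -/
noncomputable def L (N : PowerNetwork V) : Matrix V V ℝ := N.C * N.B * N.Cᵀ

/-- The weighted Laplacian `L_S = C_S B_S C_Sᵀ` of the network with set of lines `S`. -/
noncomputable def LSub (N : PowerNetwork V) (S : Set N.Line) : Matrix V V ℝ :=
  N.CSub S * N.BSub S * (N.CSub S)ᵀ

theorem L_isHermitian (N : PowerNetwork V) : N.L.IsHermitian := by
  unfold Matrix.IsHermitian L B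
  rw [Matrix.conjTranspose_eq_transpose_of_trivial, Matrix.transpose_mul, Matrix.transpose_mul,
    Matrix.transpose_transpose, Matrix.diagonal_transpose, Matrix.mul_assoc]

theorem LSub_isHermitian (N : PowerNetwork V) (S : Set N.Line) : (N.LSub S).IsHermitian := by
  unfold Matrix.IsHermitian LSub BSub B
  rw [Matrix.conjTranspose_eq_transpose_of_trivial, Matrix.transpose_mul, Matrix.transpose_mul,
    Matrix.transpose_transpose, Matrix.transpose_submatrix, Matrix.diagonal_transpose,
    Matrix.mul_assoc]

/-- The pseudo-inverse `L†`. -/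
noncomputable def LPinv (N : PowerNetwork V) : Matrix V V ℝ := symPinv N.L N.L_isHermitian

/-- The pseudo-inverse `L_S†`. -/
noncomputable def LSubPinv (N : PowerNetwork V) (S : Set N.Line) : Matrix V V ℝ :=
  symPinv (N.LSub S) (N.LSub_isHermitian S)

/-- An injection vector is balanced if it lies in the image of `L`. -/
def Balanced (N : PowerNetwork V) (p : V → ℝ) : Prop := ∃ θ : V → ℝ, N.L *ᵥ θ = p

/-- The line flows `f = B Cᵀ L† p` of the DC power flow model. -/
noncomputable def flow (N : PowerNetwork V) (p : V → ℝ) : N.Line → ℝ :=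
  (N.B * N.Cᵀ * N.LPinv) *ᵥ p

/-- The post-contingency line flows `B_S C_Sᵀ L_S† p`, `S = -E`, on the lines that survive the
outage of the set `E` of lines, with unchanged injections. -/
noncomputable def postFlow (N : PowerNetwork V) (E : Set N.Line) (p : V → ℝ) :
    (Eᶜ : Set N.Line) → ℝ :=
  (N.BSub Eᶜ * (N.CSub Eᶜ)ᵀ * N.LSubPinv Eᶜ) *ᵥ p

/-- A set of lines is a non-cut set if its deletion leaves the network connected. -/
def IsNonCut (N : PowerNetwork V) (E : Set N.Line) : Prop :=
  (N.graph.deleteEdges (Subtype.val '' E)).Connected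

/-! ### Distribution factors -/

/-- The PTDF matrix `D`: its entry at `l`, `l' = (s, t)` is the change of the flow on `l` per unit
of power injected at `s` and withdrawn at `t` (the flow is linear in the injections). -/
noncomputable def ptdf (N : PowerNetwork V) : Matrix N.Line N.Line ℝ :=
  Matrix.of fun l l' => N.flow (Pi.single (N.src l') 1 - Pi.single (N.tgt l') 1) l

/-- The submatrix of the PTDF matrix with rows in `S` and columns in `T`. -/
noncomputable def ptdfSub (N : PowerNetwork V) (S T : Set N.Line) : Matrix S T ℝ :=
  N.ptdf.submatrix Subtype.val Subtype.val

/-- The sensitivity relation `Δf_{-E} = K f_E` of a GLODF matrix: for all balanced injections, `K`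
maps the pre-contingency flows on the outaged lines to the flow changes on the surviving lines. -/
def IsGLODF (N : PowerNetwork V) (E : Set N.Line) (K : Matrix (Eᶜ : Set N.Line) E ℝ) : Prop :=
  ∀ p : V → ℝ, N.Balanced p →
    (fun l : (Eᶜ : Set N.Line) => N.postFlow E p l - N.flow p l) =
      K *ᵥ (fun l : E => N.flow p l)

/-- The GLODF matrix `K^E = D_{-E,E} (I - D_{E,E})⁻¹`. -/
noncomputable def glodf (N : PowerNetwork V) (E : Set N.Line) :
    Matrix (Eᶜ : Set N.Line) E ℝ :=
  N.ptdfSub Eᶜ E * (1 - N.ptdfSub E E)⁻¹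

/-- `κ` is the LODF of the surviving line `l` for the outage of the single line `l'`. -/
def IsLODF (N : PowerNetwork V) (l l' : N.Line) (h : l ≠ l') (κ : ℝ) : Prop :=
  ∀ p : V → ℝ, N.Balanced p → N.postFlow {l'} p ⟨l, h⟩ - N.flow p l = κ * N.flow p l'

/-! ### Partition of the outaged and of the surviving lines by blocks -/

/-- The blocks of the network. -/
abbrev Block (N : PowerNetwork V) : Type _ := Quotient N.graph.blockSetoid

/-- The block containing a line. -/
def blockOf (N : PowerNetwork V) (l : N.Line) : N.Block := Quotient.mk _ l

/-- The lines of `S` in the block `j`: this is `E_j` for `S = E` and `E_{-j}` for `S = -E`. -/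
def inBlock (N : PowerNetwork V) (S : Set N.Line) (j : N.Block) : Set N.Line :=
  {l | l ∈ S ∧ N.blockOf l = j}

/-- Indexing of the lines of `S` by pairs of a block and a line of `S` in that block. -/
def blockEquiv (N : PowerNetwork V) (S : Set N.Line) : (Σ j : N.Block, N.inBlock S j) ≃ S where
  toFun x := ⟨x.2.1, x.2.2.1⟩
  invFun l := ⟨N.blockOf l, l, l.2, rfl⟩
  left_inv := by
    rintro ⟨j, l, hl, rfl⟩
    rfl
  right_inv _ := rfl

/-- `D_{-j}`, the PTDF submatrix with rows `E_{-j}` and columns `E_j`. -/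
noncomputable def ptdfSurvBlock (N : PowerNetwork V) (E : Set N.Line) (j : N.Block) :
    Matrix (N.inBlock Eᶜ j) (N.inBlock E j) ℝ :=
  N.ptdfSub (N.inBlock Eᶜ j) (N.inBlock E j)

/-- `D_j`, the PTDF submatrix with rows and columns `E_j`. -/
noncomputable def ptdfOutBlock (N : PowerNetwork V) (E : Set N.Line) (j : N.Block) :
    Matrix (N.inBlock E j) (N.inBlock E j) ℝ :=
  N.ptdfSub (N.inBlock E j) (N.inBlock E j)

/-- `K_j = D_{-j} (I - diag D_j)⁻¹`, the submatrix of single-line LODFs of the block `j`. -/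
noncomputable def lodfBlock (N : PowerNetwork V) (E : Set N.Line) (j : N.Block) :
    Matrix (N.inBlock Eᶜ j) (N.inBlock E j) ℝ :=
  N.ptdfSurvBlock E j * (1 - Matrix.diagonal (N.ptdfOutBlock E j).diag)⁻¹

/-- `K^E_j = B_{-j} C_{-j}ᵀ L† C_j (I - B_j C_jᵀ L† C_j)⁻¹`. -/
noncomputable def glodfBlock (N : PowerNetwork V) (E : Set N.Line) (j : N.Block) :
    Matrix (N.inBlock Eᶜ j) (N.inBlock E j) ℝ :=
  N.BSub (N.inBlock Eᶜ j) * (N.CSub (N.inBlock Eᶜ j))ᵀ * N.LPinv * N.CSub (N.inBlock E j) *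
    (1 - N.BSub (N.inBlock E j) * (N.CSub (N.inBlock E j))ᵀ * N.LPinv *
      N.CSub (N.inBlock E j))⁻¹

end PowerNetwork

/-! Everything is phrased through potentials `θ`: flows are weighted potential drops, and the energy
`θᵀ L θ = ∑ b (Cᵀ θ)²` shows that a potential killed by a weighted Laplacian has no drops along its
lines. Hence `Cᵀ L† L = Cᵀ`, and flows do not depend on which potential realises an injection.

Outage formula: let `g` be the flow that the post-outage potential `θ'` would drive through the
removed lines. Then `L θ' = p + C_E g`, so the outage acts like the extra injection `C_E g` in the
intact network, and flows on all lines change by `D_{·,E} g`. On `E` this reads `f_E = (I - D_{E,E})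
g`, on `-E` it is the GLODF relation. A fixed vector of `D_{E,E}` yields a potential killed by the
surviving Laplacian; the surviving graph being connected, it is constant and the vector is zero, so
`I - D_{E,E}` is invertible.

Block structure: a potential can be truncated to a single block (`exists_block_potential`), because
two vertices of a block cannot be joined outside it. Testing the potential of a unit transfer across
`l'` against its truncation to another block shows that its energy there is zero, so `D` is
block-diagonal, and so are `(I - D_{E,E})⁻¹` and the product. Subsets of a non-cut set are non-cut,
so the results for `E` also apply to `E_j` and to single lines. -/

/-! ### Kernel of a weighted Laplacian -/

theorem IsPseudoInverse.transpose_mul_mul {m n : Type*} [Fintype m] [Fintype n]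
    {_ : DecidableEq n} {C : Matrix m n ℝ} {b : n → ℝ} (hb : ∀ l, 0 < b l) {X : Matrix m m ℝ}
    (hX : IsPseudoInverse (C * Matrix.diagonal b * Cᵀ) X) :
    Cᵀ * X * (C * Matrix.diagonal b * Cᵀ) = Cᵀ := by
  set A := C * Matrix.diagonal b * Cᵀ with hA
  have h0 : A * (1 - X * A) = 0 := by
    rw [Matrix.mul_sub, Matrix.mul_one, ← Matrix.mul_assoc, hX.mul_mul_left, sub_self]
  have key : ∀ θ : m → ℝ, A *ᵥ θ = 0 → Cᵀ *ᵥ θ = 0 := by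
    intro θ hθ
    -- Energy identity: with positive weights, zero energy forces every drop to vanish.
    have h1 : θ ⬝ᵥ (A *ᵥ θ) = ∑ l, b l * (Cᵀ *ᵥ θ) l ^ 2 := by
      rw [hA, ← Matrix.mulVec_mulVec, ← Matrix.mulVec_mulVec, Matrix.dotProduct_mulVec,
        ← Matrix.mulVec_transpose]
      refine Finset.sum_congr rfl fun l _ => ?_
      rw [Matrix.mulVec_diagonal]
      ring
    rw [hθ, dotProduct_zero] at h1
    have h2 := (Finset.sum_eq_zero_iff_of_nonneg
      (fun l _ => mul_nonneg (hb l).le (sq_nonneg _))).1 h1.symm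
    funext l
    have h3 := h2 l (Finset.mem_univ l)
    simpa [(hb l).ne'] using h3
  -- By `h0` every column of `1 - X * A` lies in the kernel of `A`.
  have h4 : Cᵀ * (1 - X * A) = 0 := by
    ext i j
    have h5 := key (fun k => (1 - X * A) k j) (by
      funext k
      exact congrFun (congrFun h0 k) j)
    exact congrFun h5 i
  rw [Matrix.mul_sub, Matrix.mul_one, ← Matrix.mul_assoc, sub_eq_zero] at h4
  exact h4.symm

/-! ### Blocks and potentials supported on one block -/

namespace SimpleGraph

variable {V : Type*} {G : SimpleGraph V}

/-- A path between two vertices of a cycle cannot avoid the block of the cycle. -/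
theorem Walk.IsPath.exists_sameBlock_of_isCycle {u a b : V} {c : G.Walk u u} (hc : c.IsCycle)
    (ha : a ∈ c.support) (hb : b ∈ c.support) {q : G.Walk a b} (hq : q.IsPath)
    {e f : G.edgeSet} (he : (e : Sym2 V) ∈ c.edges) (hf : (f : Sym2 V) ∈ q.edges) :
    G.SameBlock e f := by
  obtain ⟨x, y, r, hr, hfr, hx, hy, hrS⟩ :=
    Walk.IsPath.exists_ear {v | v ∈ c.support} _ q rfl hq hf ha hb
  have hxy : x ≠ y := by
    rintro rfl
    rw [(Walk.isPath_iff_nil.1 hr).eq_nil] at hfr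
    simp at hfr
  -- The ear `r` meets the cycle only in `x` and `y`, so it closes up to a cycle with the arc `s` of
  -- `c` through `e`.
  obtain ⟨s, hs, hes, hsS⟩ := hc.exists_isPath_of_ne hy hx hxy.symm he
  by_cases hef : e = f
  · exact Or.inl hef
  refine Or.inr ⟨x, r.append s, hr.isCycle_append hs ?_ ?_, ?_, ?_⟩
  · rw [List.disjoint_left]
    intro v hvr hvs
    have hvr' := List.mem_of_mem_tail hvr
    have hvs' := List.mem_of_mem_tail hvs
    rcases hrS v hvr' (hsS v hvs') with rfl | rfl
    · have := hr.support_nodup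
      rw [← Walk.cons_tail_support] at this
      exact (List.nodup_cons.1 this).1 hvr
    · have := hs.support_nodup
      rw [← Walk.cons_tail_support] at this
      exact (List.nodup_cons.1 this).1 hvs
  -- If the ear and the arc were both single edges, both would be the edge `xy`, whence `e = f`.
  · by_contra hlen
    push Not at hlen
    have h1 : r.length ≤ 1 := hlen.1
    have h2 : s.length ≤ 1 := hlen.2
    apply hef
    apply Subtype.ext
    have key : ∀ {s t : V} (z : G.Walk s t) (k : Sym2 V), z.length ≤ 1 → k ∈ z.edges →
        k = s(s, t) := by
      intro s t z k hz hk
      cases z with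
      | nil => simp at hk
      | cons h z' =>
        cases z' with
        | nil => simpa using hk
        | cons h' z'' => simp at hz
    rw [key r _ h1 hfr, key s _ h2 hes, Sym2.eq_swap]
  · rw [Walk.edges_append, List.mem_append]
    exact Or.inr hes
  · rw [Walk.edges_append, List.mem_append]
    exact Or.inl hfr

/-- The edges of the block containing `e`. -/
def blockEdges (G : SimpleGraph V) (e : G.edgeSet) : Set (Sym2 V) :=
  Subtype.val '' {f : G.edgeSet | G.SameBlock e f}

/-- Two vertices of a block that are connected outside of the block coincide. -/
theorem eq_of_reachable_deleteEdges_blockEdges {e f g : G.edgeSet} (hf : G.SameBlock e f)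
    (hg : G.SameBlock e g) {a b : V} (ha : a ∈ (f : Sym2 V)) (hb : b ∈ (g : Sym2 V))
    (hab : (G.deleteEdges (G.blockEdges e)).Reachable a b) : a = b := by
  by_contra hne
  obtain ⟨q', hq'⟩ := hab.exists_isPath
  have hle : G.deleteEdges (G.blockEdges e) ≤ G := G.deleteEdges_le _
  have hoff : ∀ k : G.edgeSet, (k : Sym2 V) ∈ q'.edges → ¬ G.SameBlock e k := by
    intro k hk hek
    have := q'.edges_subset_edgeSet hk
    rw [edgeSet_deleteEdges] at this
    exact this.2 ⟨k, hek, rfl⟩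
  obtain ⟨q, hq, hqe⟩ : ∃ q : G.Walk a b, q.IsPath ∧ q.edges = q'.edges :=
    ⟨q'.mapLe hle, hq'.mapLe hle, by simp⟩
  rw [← hqe] at hoff
  obtain ⟨k, hk⟩ : ∃ k : G.edgeSet, (k : Sym2 V) ∈ q.edges := by
    cases q with
    | nil => exact absurd rfl hne
    | @cons _ v _ h p => exact ⟨⟨s(a, v), h⟩, by simp⟩
  have hfg : G.SameBlock f g := (G.blockSetoid.symm hf : G.SameBlock f e).trans hg
  -- If `f = g`, this edge closes `q` to a cycle; otherwise `q` joins two vertices of a cycle of the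
  -- block. Either way the edge `k` of `q` falls into the block it was meant to avoid.
  rcases hfg with rfl | ⟨u, c, hc, hfc, hgc⟩
  · have hfab : (f : Sym2 V) = s(b, a) := by
      rw [Sym2.eq_swap]; exact (Sym2.mem_and_mem_iff hne).1 ⟨ha, hb⟩
    have hadj : G.Adj b a := by
      rw [← mem_edgeSet, ← hfab]; exact f.2
    have hfq : (f : Sym2 V) ∉ q.edges := fun h => hoff f h hf
    refine hoff k hk (hf.trans (Or.inr ⟨b, Walk.cons hadj q, ?_, ?_, ?_⟩))
    · rw [Walk.cons_isCycle_iff]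
      exact ⟨hq, hfab ▸ hfq⟩
    · simp [hfab]
    · simp [hk]
  · have hac : a ∈ c.support := Walk.mem_support_of_mem_edges hfc ha
    have hbc : b ∈ c.support := Walk.mem_support_of_mem_edges hgc hb
    exact hoff k hk (hf.trans (hq.exists_sameBlock_of_isCycle hc hac hbc hfc hk))

/-- Every potential can be modified so that its differences are unchanged along the lines of one
block and vanish along all other lines. -/
theorem exists_block_potential (θ : V → ℝ) (e : G.edgeSet) :
    ∃ φ : V → ℝ, (∀ (f : G.edgeSet), G.SameBlock e f → ∀ a ∈ (f : Sym2 V), φ a = θ a) ∧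
      ∀ (f : G.edgeSet), ¬ G.SameBlock e f → ∀ a ∈ (f : Sym2 V), ∀ b ∈ (f : Sym2 V),
        φ a = φ b := by
  let H := G.deleteEdges (G.blockEdges e)
  -- `P v a`: the block is entered from `v` at `a`. Such an `a` is unique, and `φ` copies its
  -- potential to everything hanging off it; vertices without an entry point get the value 0.
  let P : V → V → Prop := fun v a =>
    H.Reachable v a ∧ ∃ f : G.edgeSet, G.SameBlock e f ∧ a ∈ (f : Sym2 V)
  refine ⟨fun v => if h : ∃ a, P v a then θ h.choose else 0, ?_, ?_⟩
  · intro f hf a ha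
    have h : ∃ a', P a a' := ⟨a, Reachable.refl _, f, hf, ha⟩
    obtain ⟨h1, g, hg, hbg⟩ := h.choose_spec
    simp only [dif_pos h]
    rw [← eq_of_reachable_deleteEdges_blockEdges hf hg ha hbg h1]
  · intro f hf a ha b hb
    have hreach : H.Reachable a b := by
      by_cases hab : a = b
      · rw [hab]
      · have hfab := (Sym2.mem_and_mem_iff hab).1 ⟨ha, hb⟩
        refine Adj.reachable ?_
        rw [deleteEdges_adj, ← mem_edgeSet, ← hfab]
        refine ⟨f.2, ?_⟩
        rintro ⟨g, hg, hgf⟩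
        rw [Subtype.ext hgf] at hg
        exact hf hg
    -- The ends of a line outside the block have equal predicates, so the choice made for both is
    -- literally the same.
    have hP : P a = P b := by
      funext v
      exact propext ⟨fun h => ⟨hreach.symm.trans h.1, h.2⟩, fun h => ⟨hreach.trans h.1, h.2⟩⟩
    simp only [hP]

end SimpleGraph

/-! ### Matrix identities for flows and Laplacians -/

namespace PowerNetwork

variable {V : Type*}

theorem src_ne_tgt (N : PowerNetwork V) (l : N.Line) : N.src l ≠ N.tgt l := by
  have h := l.2
  rw [← N.src_tgt l, SimpleGraph.mem_edgeSet] at h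
  exact N.graph.ne_of_adj h

theorem C_col (N : PowerNetwork V) (l : N.Line) :
    N.C.col l = Pi.single (N.src l) 1 - Pi.single (N.tgt l) 1 := by
  funext i
  have h := N.src_ne_tgt l
  by_cases h1 : i = N.src l
  · subst h1
    simp [C, h]
  · by_cases h2 : i = N.tgt l
    · subst h2
      simp [C, h.symm]
    · simp [C, h1, h2]

theorem BSub_eq (N : PowerNetwork V) (S : Set N.Line) :
    N.BSub S = Matrix.diagonal fun l : S => N.susceptance l := by
  rw [BSub, B, Matrix.submatrix_diagonal _ _ Subtype.val_injective]
  rfl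

theorem IsNonCut.mono {N : PowerNetwork V} {E : Set N.Line} (hE : N.IsNonCut E)
    {F : Set N.Line} (hF : F ⊆ E) : N.IsNonCut F :=
  SimpleGraph.Connected.mono
    (SimpleGraph.deleteEdges_anti (Set.image_mono hF)) hE

variable [Fintype V] (N : PowerNetwork V)

theorem transpose_C_mulVec (θ : V → ℝ) (l : N.Line) :
    (N.Cᵀ *ᵥ θ) l = θ (N.src l) - θ (N.tgt l) := by
  change N.C.col l ⬝ᵥ θ = _
  rw [C_col, sub_dotProduct, single_one_dotProduct, single_one_dotProduct]

theorem transpose_CSub_mulVec (S : Set N.Line) (θ : V → ℝ) (l : S) :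
    ((N.CSub S)ᵀ *ᵥ θ) l = (N.Cᵀ *ᵥ θ) l := rfl

theorem BSub_mul_transpose_CSub (S : Set N.Line) {_ : Fintype S} :
    N.BSub S * (N.CSub S)ᵀ = (N.B * N.Cᵀ).submatrix Subtype.val id := by
  ext l i
  rw [BSub_eq, B, Matrix.diagonal_mul, Matrix.submatrix_apply, Matrix.diagonal_mul]
  rfl

theorem ptdf_eq : N.ptdf = N.B * N.Cᵀ * N.LPinv * N.C := by
  ext l l'
  rw [ptdf, Matrix.of_apply, ← C_col]
  rfl

theorem ptdfSub_eq (S T : Set N.Line) :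
    N.ptdfSub S T = N.BSub S * (N.CSub S)ᵀ * N.LPinv * N.CSub T := by
  rw [BSub_mul_transpose_CSub, ptdfSub, ptdf_eq]
  rfl

theorem LPinv_isPseudoInverse : IsPseudoInverse N.L N.LPinv := symPinv_isPseudoInverse _ _

theorem LSubPinv_isPseudoInverse (S : Set N.Line) : IsPseudoInverse (N.LSub S) (N.LSubPinv S) :=
  symPinv_isPseudoInverse _ _

theorem transpose_C_mul_LPinv_mul_L : N.Cᵀ * N.LPinv * N.L = N.Cᵀ :=
  N.LPinv_isPseudoInverse.transpose_mul_mul N.susceptance_pos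

theorem transpose_CSub_mul_LSubPinv_mul_LSub (S : Set N.Line) :
    (N.CSub S)ᵀ * N.LSubPinv S * N.LSub S = (N.CSub S)ᵀ := by
  have h := N.LSubPinv_isPseudoInverse S
  rw [LSub, BSub_eq] at h
  have := h.transpose_mul_mul fun l : S => N.susceptance_pos l
  rwa [LSub, BSub_eq]

/-- The unit transfer across a line is a balanced injection, so `L†` of it is a genuine potential
for it. -/
theorem L_mul_LPinv_mul_C : N.L * N.LPinv * N.C = N.C := by
  have h2 : N.Cᵀ * (N.LPinv * N.L - 1) = 0 := by
    rw [Matrix.mul_sub, ← Matrix.mul_assoc, transpose_C_mul_LPinv_mul_L, Matrix.mul_one, sub_self]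
  have h3 : (N.L * N.LPinv - 1) * N.L = 0 := by
    rw [Matrix.sub_mul, Matrix.one_mul, N.LPinv_isPseudoInverse.mul_mul_left, sub_self]
  -- Transposing `h3` gives `L (L L† - 1) = 0`, and `Cᵀ` factors through `L` on the right.
  have h4 : N.Cᵀ * (N.L * N.LPinv - 1) = 0 := by
    have h5 := congrArg Matrix.transpose h3
    have hL : N.Lᵀ = N.L := N.L_isHermitian
    rw [Matrix.transpose_mul, Matrix.transpose_sub, N.LPinv_isPseudoInverse.symm_left,
      Matrix.transpose_one, Matrix.transpose_zero, hL] at h5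
    rw [← transpose_C_mul_LPinv_mul_L, Matrix.mul_assoc, h5, Matrix.mul_zero]
  have h6 := congrArg Matrix.transpose h4
  rw [Matrix.transpose_mul, Matrix.transpose_sub, N.LPinv_isPseudoInverse.symm_left,
    Matrix.transpose_one, Matrix.transpose_zero, Matrix.transpose_transpose, Matrix.sub_mul,
    Matrix.one_mul, sub_eq_zero] at h6
  exact h6

theorem L_mul_LPinv_mul_CSub (S : Set N.Line) : N.L * N.LPinv * N.CSub S = N.CSub S := by
  conv_rhs => rw [CSub, ← L_mul_LPinv_mul_C]
  rfl

theorem LSub_add_LSub_compl (S : Set N.Line) : N.LSub S + N.LSub Sᶜ = N.L := by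
  ext i j
  simp only [Matrix.add_apply, LSub, L, BSub_eq, B, Matrix.mul_apply (N := Matrix.transpose _),
    Matrix.mul_diagonal]
  convert Fintype.sum_subtype_add_sum_subtype (· ∈ S)
    fun l => N.C i l * N.susceptance l * N.Cᵀ l j <;> rfl

/-! ### Outage of a non-cut set -/

variable {N} {E : Set N.Line}

/-- A potential without drops along the surviving lines has no drops at all. -/
theorem IsNonCut.transpose_C_mulVec_eq_zero (hE : N.IsNonCut E) {θ : V → ℝ}
    (hθ : (N.CSub Eᶜ)ᵀ *ᵥ θ = 0) : N.Cᵀ *ᵥ θ = 0 := by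
  have hadj : ∀ a b, (N.graph.deleteEdges (Subtype.val '' E)).Adj a b → θ a = θ b := by
    intro a b hab
    rw [SimpleGraph.deleteEdges_adj] at hab
    obtain ⟨h1, h2⟩ := hab
    let l : N.Line := ⟨s(a, b), h1⟩
    have hl : l ∈ Eᶜ := fun h => h2 ⟨l, h, rfl⟩
    have h3 := congrFun hθ ⟨l, hl⟩
    rw [transpose_CSub_mulVec, transpose_C_mulVec, Pi.zero_apply, sub_eq_zero] at h3
    have h4 : s(N.src l, N.tgt l) = s(a, b) := N.src_tgt l
    rcases Sym2.eq_iff.1 h4 with ⟨h5, h6⟩ | ⟨h5, h6⟩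
    · rw [← h5, ← h6, h3]
    · rw [← h5, ← h6, h3]
  have hall : ∀ a b, θ a = θ b := by
    intro a b
    obtain ⟨p⟩ := hE.preconnected a b
    induction p with
    | nil => rfl
    | cons h _ ih => exact (hadj _ _ h).trans ih
  funext l
  rw [transpose_C_mulVec, hall (N.src l) (N.tgt l), sub_self, Pi.zero_apply]

theorem transpose_CSub_mulVec_eq_zero_of_LSub {S : Set N.Line} {θ : V → ℝ}
    (h : N.LSub S *ᵥ θ = 0) : (N.CSub S)ᵀ *ᵥ θ = 0 := by
  rw [← transpose_CSub_mul_LSubPinv_mul_LSub, ← Matrix.mulVec_mulVec, h, Matrix.mulVec_zero]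

/-- If `x = D_{E,E} x`, the potential `θ = L† C_E x` has `x` as its flow on `E`, so `L θ = C_E x =
L_E θ`. Thus the surviving Laplacian kills `θ`, which has no drops, and `x = 0`. -/
theorem IsNonCut.isUnit (hE : N.IsNonCut E) : IsUnit (1 - N.ptdfSub E E) := by
  rw [← Matrix.mulVec_injective_iff_isUnit]
  refine (injective_iff_map_eq_zero (Matrix.mulVecLin (1 - N.ptdfSub E E))).2 fun x hx => ?_
  rw [Matrix.mulVecLin_apply, Matrix.sub_mulVec, Matrix.one_mulVec, sub_eq_zero, ptdfSub_eq] at hx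
  set θ := (N.LPinv * N.CSub E) *ᵥ x with hθ
  have h1 : x = N.BSub E *ᵥ (N.CSub E)ᵀ *ᵥ θ := by
    conv_lhs => rw [hx]
    simp only [hθ, Matrix.mulVec_mulVec, Matrix.mul_assoc]
  have h2 : N.L *ᵥ θ = N.LSub E *ᵥ θ := by
    rw [hθ, Matrix.mulVec_mulVec, ← Matrix.mul_assoc, L_mul_LPinv_mul_CSub, ← hθ]
    conv_lhs => rw [h1]
    simp only [LSub, Matrix.mulVec_mulVec, Matrix.mul_assoc]
  rw [← LSub_add_LSub_compl N E, Matrix.add_mulVec, add_eq_left] at h2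
  have h3 := hE.transpose_C_mulVec_eq_zero (transpose_CSub_mulVec_eq_zero_of_LSub h2)
  have h4 : (N.CSub E)ᵀ *ᵥ θ = 0 := by
    funext l
    exact congrFun h3 l
  rw [h1, h4, Matrix.mulVec_zero]

/-- A balanced injection is realised by the post-contingency potential. -/
theorem IsNonCut.LSub_mulVec_LSubPinv_mulVec (hE : N.IsNonCut E) {p : V → ℝ}
    (hp : N.Balanced p) : N.LSub Eᶜ *ᵥ (N.LSubPinv Eᶜ *ᵥ p) = p := by
  obtain ⟨θ, rfl⟩ := hp
  set Q := N.LSub Eᶜ * N.LSubPinv Eᶜ with hQ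
  have hps := N.LSubPinv_isPseudoInverse Eᶜ
  have h1 : (Q - 1) * N.LSub Eᶜ = 0 := by
    rw [Matrix.sub_mul, Matrix.one_mul, hps.mul_mul_left, sub_self]
  have h2 : N.LSub Eᶜ * (Q - 1) = 0 := by
    have := congrArg Matrix.transpose h1
    have hL : (N.LSub Eᶜ)ᵀ = N.LSub Eᶜ := N.LSub_isHermitian _
    rwa [Matrix.transpose_mul, Matrix.transpose_sub, hQ, hps.symm_left, ← hQ,
      Matrix.transpose_one, Matrix.transpose_zero, hL] at this
  -- The columns of `Q - 1` are killed by the surviving Laplacian, so connectedness removes their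
  -- drops along all lines. This turns `Q` into the identity on the image of the full `L`.
  have h3 : N.Cᵀ * (Q - 1) = 0 := by
    ext l j
    have h4 : N.LSub Eᶜ *ᵥ (Q - 1).col j = 0 := by
      funext k
      exact congrFun (congrFun h2 k) j
    exact congrFun (hE.transpose_C_mulVec_eq_zero (transpose_CSub_mulVec_eq_zero_of_LSub h4)) l
  have h5 : N.L * (Q - 1) = 0 := by rw [L, Matrix.mul_assoc, h3, Matrix.mul_zero]
  have h6 : (Q - 1) * N.L = 0 := by
    have := congrArg Matrix.transpose h5
    have hL : N.Lᵀ = N.L := N.L_isHermitian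
    rwa [Matrix.transpose_mul, Matrix.transpose_sub, hQ, hps.symm_left, ← hQ,
      Matrix.transpose_one, Matrix.transpose_zero, hL] at this
  rw [Matrix.sub_mul, Matrix.one_mul, sub_eq_zero] at h6
  rw [Matrix.mulVec_mulVec, Matrix.mulVec_mulVec, ← hQ, h6]

theorem L_mulVec_LPinv_mulVec {p : V → ℝ} (hp : N.Balanced p) :
    N.L *ᵥ (N.LPinv *ᵥ p) = p := by
  obtain ⟨θ, rfl⟩ := hp
  rw [Matrix.mulVec_mulVec, Matrix.mulVec_mulVec, N.LPinv_isPseudoInverse.mul_mul_left]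

theorem IsNonCut.isGLODF_glodf (hE : N.IsNonCut E) : N.IsGLODF E (N.glodf E) := by
  intro p hp
  set θ := N.LPinv *ᵥ p with hθ
  set θ' := N.LSubPinv Eᶜ *ᵥ p with hθ'
  have hflow : ∀ l, N.flow p l = ((N.B * N.Cᵀ) *ᵥ θ) l := fun l => by
    rw [flow, ← Matrix.mulVec_mulVec]
  have hpost : ∀ l : (Eᶜ : Set N.Line), N.postFlow E p l = ((N.B * N.Cᵀ) *ᵥ θ') l := fun l => by
    rw [postFlow, ← Matrix.mulVec_mulVec, BSub_mul_transpose_CSub]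
    rfl
  -- Fictitious flow that the post-outage potential would drive through the removed lines.
  set g : E → ℝ := fun l => ((N.B * N.Cᵀ) *ᵥ θ') l with hg
  have hg' : N.CSub E *ᵥ g = N.LSub E *ᵥ θ' := by
    have : g = (N.BSub E * (N.CSub E)ᵀ) *ᵥ θ' := by rw [BSub_mul_transpose_CSub]; rfl
    rw [this, Matrix.mulVec_mulVec, LSub, Matrix.mul_assoc]
  have h1 : N.L *ᵥ (θ' - θ) = N.CSub E *ᵥ g := by
    rw [Matrix.mulVec_sub, L_mulVec_LPinv_mulVec hp, ← LSub_add_LSub_compl N E, Matrix.add_mulVec,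
      hE.LSub_mulVec_LSubPinv_mulVec hp, add_sub_cancel_right, hg']
  have h2 : (N.B * N.Cᵀ) *ᵥ (θ' - θ) = (N.B * N.Cᵀ * N.LPinv) *ᵥ (N.CSub E *ᵥ g) := by
    rw [← h1, Matrix.mulVec_mulVec, Matrix.mul_assoc N.B, Matrix.mul_assoc N.B,
      transpose_C_mul_LPinv_mul_L]
  -- Used twice: `S = E` expresses `f_E` through `g`, `S = Eᶜ` gives the flow changes on surviving
  -- lines.
  have h3 : ∀ (S : Set N.Line) (l : S),
      ((N.B * N.Cᵀ) *ᵥ θ') l - ((N.B * N.Cᵀ) *ᵥ θ) l = (N.ptdfSub S E *ᵥ g) l := by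
    intro S l
    rw [← Pi.sub_apply, ← Matrix.mulVec_sub, h2, ptdfSub_eq, BSub_mul_transpose_CSub,
      Matrix.mulVec_mulVec]
    rfl
  have h4 : (fun l : E => N.flow p l) = (1 - N.ptdfSub E E) *ᵥ g := by
    funext l
    rw [Matrix.sub_mulVec, Matrix.one_mulVec, Pi.sub_apply, ← h3, hflow, hg]
    ring
  have hu := (Matrix.isUnit_iff_isUnit_det _).1 hE.isUnit
  rw [h4, glodf, Matrix.mulVec_mulVec, Matrix.nonsing_inv_mul_cancel_right _ _ hu]
  funext l
  rw [hpost, hflow, h3]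

/-! ### Block-diagonal form -/

/-- Lines in different blocks have no influence on each other. -/
theorem ptdf_eq_zero_of_blockOf_ne {l l' : N.Line} (h : N.blockOf l ≠ N.blockOf l') :
    N.ptdf l l' = 0 := by
  set θ := N.LPinv *ᵥ N.C.col l' with hθ
  obtain ⟨φ, hφ, hφ'⟩ := SimpleGraph.exists_block_potential θ l
  have hL : N.L *ᵥ θ = N.C.col l' := by
    rw [hθ, Matrix.mulVec_mulVec]
    funext i
    exact congrFun (congrFun N.L_mul_LPinv_mul_C i) l'
  have hmem : ∀ k : N.Line, N.src k ∈ (k : Sym2 V) ∧ N.tgt k ∈ (k : Sym2 V) := by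
    intro k
    rw [← N.src_tgt k]
    exact ⟨Sym2.mem_mk_left _ _, Sym2.mem_mk_right _ _⟩
  have hin : ∀ k, N.graph.SameBlock l k → (N.Cᵀ *ᵥ φ) k = (N.Cᵀ *ᵥ θ) k := by
    intro k hk
    rw [transpose_C_mulVec, transpose_C_mulVec, hφ k hk _ (hmem k).1, hφ k hk _ (hmem k).2]
  have hout : ∀ k, ¬ N.graph.SameBlock l k → (N.Cᵀ *ᵥ φ) k = 0 := by
    intro k hk
    rw [transpose_C_mulVec, hφ' k hk _ (hmem k).1 _ (hmem k).2, sub_self]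
  have hl' : ¬ N.graph.SameBlock l l' := fun hs => h (Quotient.sound hs)
  -- The pairing is the drop of `φ` across `l'`, a line outside the block of `l`. By `h2` it is also
  -- the energy of `φ`, whose drops either agree with those of `θ` or vanish.
  have h1 : φ ⬝ᵥ (N.L *ᵥ θ) = 0 := by
    rw [hL, dotProduct_comm]
    exact hout l' hl'
  have h2 : φ ⬝ᵥ (N.L *ᵥ θ) = ∑ k, N.susceptance k * (N.Cᵀ *ᵥ φ) k ^ 2 := by
    rw [L, B, ← Matrix.mulVec_mulVec, ← Matrix.mulVec_mulVec, Matrix.dotProduct_mulVec,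
      ← Matrix.mulVec_transpose]
    refine Finset.sum_congr rfl fun k _ => ?_
    rw [Matrix.mulVec_diagonal]
    by_cases hk : N.graph.SameBlock l k
    · rw [hin k hk]
      ring
    · rw [hout k hk]
      ring
  have h3 := (Finset.sum_eq_zero_iff_of_nonneg
    (fun k _ => mul_nonneg (N.susceptance_pos k).le (sq_nonneg _))).1 (h2.symm.trans h1) l
    (Finset.mem_univ l)
  have h4 : (N.Cᵀ *ᵥ θ) l = 0 := by
    rw [← hin l (Or.inl rfl)]
    simpa [(N.susceptance_pos l).ne'] using h3
  have h5 : N.ptdf l l' = N.susceptance l * (N.Cᵀ *ᵥ θ) l := by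
    rw [hθ, ← Matrix.mulVec_diagonal, Matrix.mulVec_mulVec, Matrix.mulVec_mulVec, ptdf_eq, B]
    rfl
  rw [h5, h4, mul_zero]

theorem glodfBlock_eq (E : Set N.Line) (j : N.Block) :
    N.glodfBlock E j = N.ptdfSurvBlock E j * (1 - N.ptdfOutBlock E j)⁻¹ := by
  rw [glodfBlock, ptdfSurvBlock, ptdfOutBlock, ptdfSub_eq, ptdfSub_eq]

theorem ptdfSub_submatrix_blockEquiv (S T : Set N.Line) :
    (N.ptdfSub S T).submatrix (N.blockEquiv S) (N.blockEquiv T) =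
      Matrix.blockDiagonal' fun j => N.ptdfSub (N.inBlock S j) (N.inBlock T j) := by
  ext ⟨j, l, hl⟩ ⟨j', l', hl'⟩
  by_cases hj : j = j'
  · subst hj
    rw [Matrix.blockDiagonal'_apply_eq]
    rfl
  · rw [Matrix.blockDiagonal'_apply_ne _ _ _ hj]
    refine ptdf_eq_zero_of_blockOf_ne ?_
    change N.blockOf l ≠ N.blockOf l'
    rw [hl.2, hl'.2]
    exact hj

/-- `E_j` is itself a non-cut set, so the invertibility result applies to it in place of `E`. -/
theorem IsNonCut.isUnit_outBlock (hE : N.IsNonCut E) (j : N.Block) :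
    IsUnit (1 - N.ptdfOutBlock E j) :=
  (hE.mono (F := N.inBlock E j) fun _ h => h.1).isUnit

theorem IsNonCut.glodf_submatrix_blockEquiv (hE : N.IsNonCut E) :
    (N.glodf E).submatrix (N.blockEquiv Eᶜ) (N.blockEquiv E) =
      Matrix.blockDiagonal' fun j => N.glodfBlock E j := by
  have h1 : (1 - N.ptdfSub E E).submatrix (N.blockEquiv E) (N.blockEquiv E) =
      Matrix.blockDiagonal' fun j => 1 - N.ptdfOutBlock E j := by
    rw [Matrix.submatrix_sub, Pi.sub_apply, Pi.sub_apply, ptdfSub_submatrix_blockEquiv,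
      Matrix.submatrix_one_equiv, ← Matrix.blockDiagonal'_one, ← Matrix.blockDiagonal'_sub]
    rfl
  have h2 : ((1 - N.ptdfSub E E).submatrix (N.blockEquiv E) (N.blockEquiv E))⁻¹ =
      Matrix.blockDiagonal' fun j => (1 - N.ptdfOutBlock E j)⁻¹ := by
    -- A right inverse suffices for square matrices, so it is enough to multiply block by block.
    refine Matrix.inv_eq_right_inv ?_
    rw [h1, ← Matrix.blockDiagonal'_mul, ← Matrix.blockDiagonal'_one]
    congr 1
    funext j
    exact Matrix.mul_nonsing_inv _ ((Matrix.isUnit_iff_isUnit_det _).1 (hE.isUnit_outBlock j))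
  rw [glodf, ← Matrix.submatrix_mul_equiv _ _ _ (N.blockEquiv E) _, ← Matrix.inv_submatrix_equiv,
    h2, ptdfSub_submatrix_blockEquiv, ← Matrix.blockDiagonal'_mul]
  congr 1
  funext j
  rw [glodfBlock_eq]
  rfl

/-! ### Single-line outages -/

theorem IsNonCut.one_sub_ptdf_ne_zero_of_eq_singleton (hE : N.IsNonCut E) {l : N.Line}
    (hl : E = {l}) : 1 - N.ptdf l l ≠ 0 := by
  -- With a single index, the determinant of `1 - D_{E,E}` is its only entry.
  let _ : Unique E :=
    ⟨⟨⟨l, by simp [hl]⟩⟩, fun k => Subtype.ext (Set.mem_singleton_iff.1 (hl.subset k.2))⟩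
  have h := (Matrix.isUnit_iff_isUnit_det _).1 hE.isUnit
  rw [Matrix.det_unique, Matrix.sub_apply, Matrix.one_apply_eq] at h
  exact h.ne_zero

theorem IsNonCut.glodf_mulVec_of_eq_singleton (hE : N.IsNonCut E) {l' : N.Line} (hl' : E = {l'})
    (f : N.Line → ℝ) (l : (Eᶜ : Set N.Line)) :
    (N.glodf E *ᵥ fun k : E => f k) l = N.ptdf l l' * (1 - N.ptdf l' l')⁻¹ * f l' := by
  let _ : Unique E :=
    ⟨⟨⟨l', by simp [hl']⟩⟩, fun k => Subtype.ext (Set.mem_singleton_iff.1 (hl'.subset k.2))⟩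
  have h : N.glodf E * (1 - N.ptdfSub E E) = N.ptdfSub Eᶜ E :=
    Matrix.nonsing_inv_mul_cancel_right _ _ ((Matrix.isUnit_iff_isUnit_det _).1 hE.isUnit)
  have h1 := congrFun (congrFun h l) default
  rw [Matrix.mul_apply, Fintype.sum_unique, Matrix.sub_apply, Matrix.one_apply_eq] at h1
  have h2 := (eq_mul_inv_iff_mul_eq₀ (hE.one_sub_ptdf_ne_zero_of_eq_singleton hl')).2 h1
  rw [Matrix.mulVec, dotProduct, Fintype.sum_unique, h2]
  rfl

theorem IsNonCut.one_sub_ptdf_ne_zero (hE : N.IsNonCut E) {l : N.Line} (hl : l ∈ E) :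
    1 - N.ptdf l l ≠ 0 :=
  (hE.mono (Set.singleton_subset_iff.2 hl)).one_sub_ptdf_ne_zero_of_eq_singleton rfl

/-- This is the GLODF relation for the outage set `{l'}`, where the matrix inverse is a scalar one.
-/
theorem IsNonCut.isLODF (hE : N.IsNonCut E) {l l' : N.Line} (hl' : l' ∈ E) (h : l ≠ l') :
    N.IsLODF l l' h (N.ptdf l l' * (1 - N.ptdf l' l')⁻¹) := by
  intro p hp
  have hs := hE.mono (Set.singleton_subset_iff.2 hl')
  exact (congrFun (hs.isGLODF_glodf p hp) ⟨l, h⟩).trans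
    (hs.glodf_mulVec_of_eq_singleton rfl (N.flow p) ⟨l, h⟩)

theorem IsNonCut.isUnit_one_sub_diag (hE : N.IsNonCut E) (j : N.Block) :
    IsUnit (1 - Matrix.diagonal (N.ptdfOutBlock E j).diag) := by
  rw [← Matrix.diagonal_one, Matrix.diagonal_sub, Matrix.isUnit_diagonal, Pi.isUnit_iff]
  intro l
  exact (hE.one_sub_ptdf_ne_zero l.2.1).isUnit

theorem IsNonCut.lodfBlock_apply (hE : N.IsNonCut E) (j : N.Block) (l : N.inBlock Eᶜ j)
    (l' : N.inBlock E j) :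
    N.lodfBlock E j l l' = N.ptdf l l' * (1 - N.ptdf l' l')⁻¹ := by
  have h : (1 - Matrix.diagonal (N.ptdfOutBlock E j).diag)⁻¹ =
      Matrix.diagonal fun k : N.inBlock E j => (1 - N.ptdf k k)⁻¹ := by
    refine Matrix.inv_eq_right_inv ?_
    rw [← Matrix.diagonal_one, Matrix.diagonal_sub, Matrix.diagonal_mul_diagonal]
    congr 1
    funext k
    exact mul_inv_cancel₀ (hE.one_sub_ptdf_ne_zero k.2.1)
  rw [lodfBlock, h, Matrix.mul_diagonal]
  rfl

theorem IsNonCut.glodf_eq_zero (hE : N.IsNonCut E) (l : (Eᶜ : Set N.Line)) (l' : E)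
    (h : N.blockOf l ≠ N.blockOf l') : N.glodf E l l' = 0 := by
  have h1 := congrFun (congrFun hE.glodf_submatrix_blockEquiv ((N.blockEquiv Eᶜ).symm l))
    ((N.blockEquiv E).symm l')
  rw [Matrix.submatrix_apply, Equiv.apply_symm_apply, Equiv.apply_symm_apply] at h1
  rw [h1]
  exact Matrix.blockDiagonal'_apply_ne _ _ _ h

end PowerNetwork

theorem mainTheorem1 {V : Type*} [Fintype V] (N : PowerNetwork V) (E : Set N.Line)
    (hE : N.IsNonCut E) :
    -- the GLODF matrix `K^E` is well defined and gives the flow changes after the outage of `E`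
    IsUnit (1 - N.ptdfSub E E) ∧
    N.IsGLODF E (N.glodf E) ∧
    -- `K^E` is block-diagonal, with diagonal pieces `K^E_j` indexed by the blocks of the network
    (N.glodf E).submatrix (N.blockEquiv Eᶜ) (N.blockEquiv E) =
      Matrix.blockDiagonal' (fun j : N.Block => N.glodfBlock E j) ∧
    -- `K^E_j = D_{-j} (I - D_j)⁻¹ = K_j (I - diag D_j) (I - D_j)⁻¹`, where both inverses exist and
    -- `K_j` consists of the LODFs of single-line outages
    (∀ j : N.Block,
      IsUnit (1 - N.ptdfOutBlock E j) ∧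
      IsUnit (1 - Matrix.diagonal (N.ptdfOutBlock E j).diag) ∧
      N.glodfBlock E j = N.ptdfSurvBlock E j * (1 - N.ptdfOutBlock E j)⁻¹ ∧
      N.glodfBlock E j =
        N.lodfBlock E j * (1 - Matrix.diagonal (N.ptdfOutBlock E j).diag) *
          (1 - N.ptdfOutBlock E j)⁻¹ ∧
      ∀ (l : N.inBlock Eᶜ j) (l' : N.inBlock E j) (h : (l : N.Line) ≠ l'),
        N.IsLODF l l' h (N.lodfBlock E j l l')) ∧
    -- lines in different blocks do not influence each other
    (∀ (l : (Eᶜ : Set N.Line)) (l' : E), N.blockOf l ≠ N.blockOf l' → N.glodf E l l' = 0) := by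
  refine ⟨hE.isUnit, hE.isGLODF_glodf, hE.glodf_submatrix_blockEquiv, fun j => ?_,
    hE.glodf_eq_zero⟩
  refine ⟨hE.isUnit_outBlock j, hE.isUnit_one_sub_diag j, PowerNetwork.glodfBlock_eq E j, ?_, ?_⟩
  · rw [PowerNetwork.lodfBlock, Matrix.nonsing_inv_mul_cancel_right _ _
      ((Matrix.isUnit_iff_isUnit_det _).1 (hE.isUnit_one_sub_diag j))]
    exact PowerNetwork.glodfBlock_eq E j
  · intro l l' h
    rw [hE.lodfBlock_apply]
    exact hE.isLODF l'.2.1 h
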